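/- For $\tau$ in the upper half-plane put $q=e^{2\pi i\tau}$, let $\eta(\tau)=e^{\pi i\tau/12}\prod_{n\ge1}(1-q^n)$ be the Dedekind eta function, and let $\Phi_2(q)$, $G_2(q)$, $G_8(q)$ be the power series in $q$ given by $$\Phi_2(q)=\frac{\eta(2\tau)}{\eta(\tau)^2},\qquad G_2(q)=\left(\frac{\eta(2\tau)}{\eta(\tau)}\right)^{24},\qquad G_8(q)=\frac{\eta(8\tau)^4\,\eta(2\tau)^2}{\eta(4\tau)^2\,\eta(\tau)^4}.$$ For a power series $F(q)=\sum_{n\ge0}a(n)q^n$ let $F\,|\,U_2=\sum_{n\ge0}a(2n)q^n$, and let $\pi_2$ denote the $2$-adic valuation on $\mathbb{Z}$, with $\pi_2(0)=\infty$. Then for every integer $s\ge0$ there exist integers $c_{1r}^s$ ($\lceil s/2\rceil\le r\le 8s+1$) such that $$\bigl(\Phi_2(-q)\,G_2(-q)^s\bigr)\,\big|\,U_2=\Phi_2(-q^2)\sum_{r=\lceil s/2\rceil}^{8s+1}c_{1r}^s\,G_8(q)^r$$ and $$\pi_2(c_{1r}^s)\ge 2r-s\qquad\text{for all }\lceil s/2\rceil\le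 r\le 8s+1.$$ -/

import Mathlib

open scoped ModularForm UpperHalfPlane

noncomputable section

namespace OverpartitionU

/-- The eta quotient `φ₂(τ) = η(2τ) / η(τ)²`. -/
def phi2 (τ : ℍ) : ℂ := η (2 * (τ : ℂ)) / η (τ : ℂ) ^ 2

/-- The eta quotient `g₂(τ) = (η(2τ) / η(τ))²⁴`. -/
def g2 (τ : ℍ) : ℂ := (η (2 * (τ : ℂ)) / η (τ : ℂ)) ^ 24

/-- The eta quotient `g₈(τ) = η(8τ)⁴ η(2τ)² / (η(4τ)² η(τ)⁴)`. -/
def g8 (τ : ℍ) : ℂ :=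
  (η (8 * (τ : ℂ)) ^ 4 * η (2 * (τ : ℂ)) ^ 2) / (η (4 * (τ : ℂ)) ^ 2 * η (τ : ℂ) ^ 4)

/-- `Φ₂(q)`: the expansion of `φ₂(τ)` in powers of `q = exp(2πiτ)`. -/
def Phi2 : PowerSeries ℂ := UpperHalfPlane.qExpansion 1 phi2

/-- `G₂(q)`: the expansion of `g₂(τ)` in powers of `q = exp(2πiτ)`. -/
def G2 : PowerSeries ℂ := UpperHalfPlane.qExpansion 1 g2

/-- `G₈(q)`: the expansion of `g₈(τ)` in powers of `q = exp(2πiτ)`. -/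
def G8 : PowerSeries ℂ := UpperHalfPlane.qExpansion 1 g8

/-- For a power series `F(q)`, the power series `F(-q)`. -/
def atNeg (F : PowerSeries ℂ) : PowerSeries ℂ := PowerSeries.rescale (-1) F

/-- For a power series `F(q)`, the power series `F(q²)`. -/
def atSq (F : PowerSeries ℂ) : PowerSeries ℂ := PowerSeries.expand 2 two_ne_zero F

/-- Atkin's operator `U_p`: it sends `∑ a(n) qⁿ` to `∑ a(p n) qⁿ`. -/
def atkinU (p : ℕ) (F : PowerSeries ℂ) : PowerSeries ℂ :=
  PowerSeries.mk fun n => PowerSeries.coeff (p * n) F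

end OverpartitionU

end

namespace OverpartitionU

open Filter Topology

/-! Put φ(q) = ∑ q^(n²). Then `thetaNeg q` is φ(-q) and Φ₂(q) = 1/φ(-q). Gauss's theta identities
express everything through u = φ(-q)/φ(q) and v = 1/u: with y = G₈(q²), g = G₂(-q), h = G₂(q), one
has 16y = u + v - 2, 16g = u⁸ - u⁴ and 16h = v⁸ - v⁴.

Applying U₂ and then q ↦ q² averages a series over q ↦ -q, which exchanges u with v and g with h.
Multiplication by φ(q) + φ(-q) = 2φ(q⁴) clears the denominators and leaves (1 + u)g^s + (1 + v)h^s.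
This is symmetric in u and v, where uv = 1, hence a polynomial 4P_s(y) (`eval₂_atkinPoly`,
`atkinU_eq_eval₂`).

Since g + h and -gh are the polynomials `tracePoly` and `normPoly` in y, P_s obeys a two-term
recurrence. The bound on valuations is a grading (`IsGraded`): weights add under products,
`tracePoly` and `normPoly` have weights 1 and 2, and P_0, P_1 have weights 0 and 1, so P_s has
weight s. The degree bound follows from the same recurrence.

The theta identities rest on the Jacobi triple product. They are proved for functions on the unit
disc and pass to formal series by uniqueness of Taylor coefficients. -/

/-! ### Gaussian binomials and the Jacobi triple product. -/

/-- The Gaussian binomial coefficient `[n, k]` at `Q`. -/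
noncomputable def gaussBinom (Q : ℂ) : ℕ → ℕ → ℂ
  | _, 0 => 1
  | 0, _ + 1 => 0
  | n + 1, k + 1 => gaussBinom Q n k + Q ^ (k + 1) * gaussBinom Q n (k + 1)

lemma gaussBinom_zero_right (Q : ℂ) (n : ℕ) : gaussBinom Q n 0 = 1 := by
  cases n <;> rfl

lemma gaussBinom_eq_zero_of_lt (Q : ℂ) {n k : ℕ} (h : n < k) : gaussBinom Q n k = 0 := by
  induction n generalizing k with
  | zero => obtain ⟨k, rfl⟩ := Nat.exists_eq_succ_of_ne_zero h.ne'; rfl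
  | succ n ih =>
    obtain ⟨k, rfl⟩ := Nat.exists_eq_succ_of_ne_zero (Nat.ne_zero_of_lt h)
    simp [gaussBinom, ih (show n < k by omega), ih (show n < k + 1 by omega)]

/-- The finite `q`-binomial theorem. -/
lemma prod_one_add_mul_pow (Q x : ℂ) (n : ℕ) :
    ∏ i ∈ Finset.range n, (1 + x * Q ^ i) =
      ∑ k ∈ Finset.range (n + 1), gaussBinom Q n k * Q ^ k.choose 2 * x ^ k := by
  induction n generalizing x with
  | zero => simp [gaussBinom]
  | succ n ih =>
    have h := ih (x * Q)
    rw [Finset.prod_range_succ']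
    have h1 : ∀ i, 1 + x * Q ^ (i + 1) = 1 + x * Q * Q ^ i := fun i ↦ by ring
    simp only [h1, h]
    have h2 : ∑ k ∈ Finset.range (n + 1), gaussBinom Q n k * Q ^ k.choose 2 * (x * Q) ^ k =
        ∑ k ∈ Finset.range (n + 2), gaussBinom Q n k * Q ^ k.choose 2 * (x * Q) ^ k := by
      rw [Finset.sum_range_succ _ (n + 1), gaussBinom_eq_zero_of_lt Q (Nat.lt_succ_self n)]
      simp
    rw [pow_zero, mul_one, mul_add, mul_one]
    nth_rewrite 1 [h2]
    rw [Finset.sum_range_succ' _ (n + 1), Finset.sum_range_succ' _ (n + 1), Finset.sum_mul,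
      add_right_comm, ← Finset.sum_add_distrib]
    simp only [gaussBinom_zero_right]
    congr 1
    refine Finset.sum_congr rfl fun k _ ↦ ?_
    have : (k + 1).choose 2 = k + k.choose 2 := by
      rw [Nat.choose_succ_succ' k 1, Nat.choose_one_right]
    rw [gaussBinom, this]
    ring

/-- The `q`-Pochhammer product `(1 - Q) ⋯ (1 - Q ^ n)`. -/
noncomputable def poch (Q : ℂ) (n : ℕ) : ℂ := ∏ i ∈ Finset.range n, (1 - Q ^ (i + 1))

lemma poch_succ (Q : ℂ) (n : ℕ) : poch Q (n + 1) = poch Q n * (1 - Q ^ (n + 1)) :=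
  Finset.prod_range_succ _ _

/-- The Pascal recursion reduces this to (1 - Q^(k+1)) + Q^(k+1)(1 - Q^(m+1)) = 1 - Q^(k+m+2). -/
lemma gaussBinom_mul_poch (Q : ℂ) {n k : ℕ} (h : k ≤ n) :
    gaussBinom Q n k * poch Q k * poch Q (n - k) = poch Q n := by
  induction n generalizing k with
  | zero => obtain rfl : k = 0 := by omega
            simp [gaussBinom, poch]
  | succ n ih =>
    cases k with
    | zero => simp [gaussBinom, poch]
    | succ k =>
      obtain ⟨m, rfl⟩ : ∃ m, n = k + m := ⟨n - k, by omega⟩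
      have h1 := ih (show k ≤ k + m by omega)
      rw [show k + m + 1 - (k + 1) = m by omega, gaussBinom, poch_succ, poch_succ Q (k + m)]
      rw [show k + m - k = m by omega] at h1
      cases m with
      | zero =>
        rw [gaussBinom_eq_zero_of_lt Q (show k + 0 < k + 1 by omega)]
        linear_combination (1 - Q ^ (k + 1)) * h1
      | succ m =>
        have h2 := ih (show k + 1 ≤ k + (m + 1) by omega)
        rw [show k + (m + 1) - (k + 1) = m by omega, poch_succ Q k] at h2
        rw [poch_succ Q m] at h1 ⊢
        linear_combination (1 - Q ^ (k + 1)) * h1 + Q ^ (k + 1) * (1 - Q ^ (m + 1)) * h2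

/-- Euler's product `∏ (1 - q ^ (n + 1))`. -/
noncomputable def euler (q : ℂ) : ℂ := ∏' n : ℕ, (1 - q ^ (n + 1))

lemma one_sub_pow_ne_zero {q : ℂ} (hq : ‖q‖ < 1) (n : ℕ) : 1 - q ^ (n + 1) ≠ 0 := by
  intro h
  have h1 : ‖q ^ (n + 1)‖ < 1 := by
    rw [norm_pow]; exact pow_lt_one₀ (norm_nonneg _) hq n.succ_ne_zero
  rw [← sub_eq_zero.mp h, norm_one] at h1
  exact lt_irrefl _ h1

lemma poch_ne_zero {q : ℂ} (hq : ‖q‖ < 1) (n : ℕ) : poch q n ≠ 0 :=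
  Finset.prod_ne_zero_iff.mpr fun _ _ ↦ one_sub_pow_ne_zero hq _

lemma euler_ne_zero {q : ℂ} (hq : ‖q‖ < 1) : euler q ≠ 0 := by
  refine tprod_one_add_ne_zero_of_summable (f := fun n ↦ -q ^ (n + 1)) ?_ ?_
  · exact fun i ↦ by simpa [sub_eq_add_neg] using one_sub_pow_ne_zero hq i
  · simpa using (summable_nat_add_iff 1).mpr (summable_geometric_of_lt_one (norm_nonneg _) hq)

lemma tendsto_poch {q : ℂ} (hq : ‖q‖ < 1) : Tendsto (poch q) atTop (𝓝 (euler q)) :=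
  (ModularForm.multipliable_one_sub_pow hq).hasProd.tendsto_prod_nat

/-- Cauchy's finite form of the Jacobi triple product. -/
lemma prod_eq_sum_gaussBinom {q z : ℂ} (hq : q ≠ 0) (hz : z ≠ 0) (N : ℕ) :
    ∏ i ∈ Finset.range N, ((1 + z * q ^ (2 * i + 1)) * (1 + z⁻¹ * q ^ (2 * i + 1))) =
      ∑ k ∈ Finset.range (2 * N + 1), gaussBinom (q ^ 2) (2 * N) k *
        (q ^ (((k : ℤ) - N) ^ 2) * z ^ ((k : ℤ) - N)) := by
  -- The shift by q^(1-2N) centres the exponents of q at zero: the first N factors, read backwards,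
  -- become the factors in z⁻¹ once z q^(-(2i+1)) is pulled out of each.
  have key := prod_one_add_mul_pow (q ^ 2) (z * q ^ (1 - 2 * (N : ℤ))) (2 * N)
  have hl : ∏ i ∈ Finset.range (2 * N), (1 + z * q ^ (1 - 2 * (N : ℤ)) * (q ^ 2) ^ i) =
      z ^ N * q ^ (-(N : ℤ) ^ 2) *
      ∏ i ∈ Finset.range N, ((1 + z * q ^ (2 * i + 1)) * (1 + z⁻¹ * q ^ (2 * i + 1))) := by
    rw [two_mul N, Finset.prod_range_add, Finset.prod_mul_distrib,
      mul_comm (∏ i ∈ Finset.range N, (1 + z * q ^ (2 * i + 1))), ← mul_assoc]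
    congr 1
    · rw [← Finset.prod_range_reflect]
      have h1 : z ^ N * q ^ (-(N : ℤ) ^ 2) =
          ∏ i ∈ Finset.range N, (z * q ^ (-(2 * (i : ℤ) + 1))) := by
        rw [Finset.prod_mul_distrib, Finset.prod_const, Finset.card_range]
        congr 1
        clear key
        induction N with
        | zero => simp
        | succ n ih =>
          rw [Finset.prod_range_succ, ← ih, ← zpow_add₀ hq]
          congr 1; push_cast; ring
      rw [h1, ← Finset.prod_mul_distrib]
      refine Finset.prod_congr rfl fun i hi ↦ ?_
      have hi' := Finset.mem_range.mp hi
      have h2 : z * q ^ (1 - 2 * (N : ℤ)) * (q ^ 2) ^ (N - 1 - i) =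
          z * q ^ (-(2 * (i : ℤ) + 1)) := by
        rw [← pow_mul, ← zpow_natCast, mul_assoc, ← zpow_add₀ hq]
        congr 2
        omega
      have h3 : z * q ^ (-(2 * (i : ℤ) + 1)) * (z⁻¹ * q ^ (2 * i + 1)) = 1 := by
        rw [mul_mul_mul_comm, mul_inv_cancel₀ hz, one_mul, ← zpow_natCast q (2 * i + 1),
          ← zpow_add₀ hq]
        simp
      rw [h2, mul_add, h3, mul_one, add_comm]
    · refine Finset.prod_congr rfl fun i _ ↦ ?_
      rw [← pow_mul, ← zpow_natCast, mul_assoc, ← zpow_add₀ hq, ← zpow_natCast q (2 * i + 1)]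
      congr 3
      push_cast; ring
  rw [hl] at key
  have hc : z ^ N * q ^ (-(N : ℤ) ^ 2) ≠ 0 := mul_ne_zero (pow_ne_zero _ hz) (zpow_ne_zero _ hq)
  apply mul_left_cancel₀ hc
  rw [key, Finset.mul_sum]
  refine Finset.sum_congr rfl fun k _ ↦ ?_
  have hch : (2 : ℤ) * (k.choose 2 : ℤ) = k * (k - 1) := by
    cases k with
    | zero => simp
    | succ k =>
      have h5 : (k + 1).choose 2 * 2 = (k + 1) * k := by
        rw [Nat.choose_two_right]
        exact Nat.div_mul_cancel (even_iff_two_dvd.mp (by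
          rw [Nat.add_sub_cancel, mul_comm]; exact Nat.even_mul_succ_self k))
      push_cast
      have h6 : (((k + 1).choose 2 : ℕ) : ℤ) * 2 = (k + 1) * k := by exact_mod_cast h5
      linarith
  rw [mul_pow, ← pow_mul, ← zpow_natCast q (2 * _), ← zpow_natCast (q ^ _) k, ← zpow_mul,
    ← zpow_natCast z, ← zpow_natCast z]
  calc _ = gaussBinom (q ^ 2) (2 * N) k * (z ^ (k : ℤ)) *
        (q ^ ((2 * k.choose 2 : ℕ) : ℤ) * q ^ ((1 - 2 * (N : ℤ)) * k)) := by ring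
    _ = gaussBinom (q ^ 2) (2 * N) k * (z ^ (N : ℤ) * z ^ ((k : ℤ) - N)) *
        (q ^ (-(N : ℤ) ^ 2) * q ^ (((k : ℤ) - N) ^ 2)) := by
      rw [← zpow_add₀ hq, ← zpow_add₀ hq, ← zpow_add₀ hz]
      congr 2
      · congr 1; ring
      · push_cast; rw [hch]; ring
    _ = _ := by ring

/-- The Pochhammer products converge to a nonzero limit, so they and their inverses are bounded.
Uniformity in n and k supplies the dominating series in `hasSum_tripleProduct`. -/
lemma exists_norm_gaussBinom_le {Q : ℂ} (hQ : ‖Q‖ < 1) :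
    ∃ C, 0 ≤ C ∧ ∀ n k, ‖gaussBinom Q n k‖ ≤ C := by
  obtain ⟨A, hA⟩ := (Metric.isBounded_range_of_tendsto _ (tendsto_poch hQ)).exists_norm_le
  obtain ⟨B, hB⟩ := (Metric.isBounded_range_of_tendsto _
    ((tendsto_poch hQ).inv₀ (euler_ne_zero hQ))).exists_norm_le
  have hA' : ∀ n, ‖poch Q n‖ ≤ A := fun n ↦ hA _ ⟨n, rfl⟩
  have hB' : ∀ n, ‖(poch Q n)⁻¹‖ ≤ B := fun n ↦ hB _ ⟨n, rfl⟩
  have hA0 : 0 ≤ A := (norm_nonneg _).trans (hA' 0)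
  have hB0 : 0 ≤ B := (norm_nonneg _).trans (hB' 0)
  refine ⟨A * B * B, by positivity, fun n k ↦ ?_⟩
  rcases lt_or_ge n k with h | h
  · rw [gaussBinom_eq_zero_of_lt Q h, norm_zero]; positivity
  · have h1 : gaussBinom Q n k = poch Q n * (poch Q k)⁻¹ * (poch Q (n - k))⁻¹ := by
      rw [← gaussBinom_mul_poch Q h]
      field_simp [poch_ne_zero hQ k, poch_ne_zero hQ (n - k)]
    rw [h1, norm_mul, norm_mul]
    gcongr
    exacts [hA' _, hB' _, hB' _]

/-- The coefficient of `q ^ (n ^ 2) * z ^ n` in the finite form of the triple product. -/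
noncomputable def tripleCoeff (Q : ℂ) (N : ℕ) (n : ℤ) : ℂ :=
  if n.natAbs ≤ N then gaussBinom Q (2 * N) (N + n).toNat else 0

lemma tendsto_tripleCoeff {Q : ℂ} (hQ : ‖Q‖ < 1) (n : ℤ) :
    Tendsto (fun N ↦ tripleCoeff Q N n) atTop (𝓝 (euler Q)⁻¹) := by
  have hp := tendsto_poch hQ
  have h1 : Tendsto (fun N : ℕ ↦ (N + n).toNat) atTop atTop :=
    tendsto_atTop.mpr fun b ↦ by
      filter_upwards [eventually_ge_atTop (b + n.natAbs)] with N hN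
      omega
  have h2 : Tendsto (fun N : ℕ ↦ (N - n).toNat) atTop atTop :=
    tendsto_atTop.mpr fun b ↦ by
      filter_upwards [eventually_ge_atTop (b + n.natAbs)] with N hN
      omega
  have h3 : Tendsto (fun N : ℕ ↦ 2 * N) atTop atTop :=
    tendsto_atTop.mpr fun b ↦ by
      filter_upwards [eventually_ge_atTop b] with N hN
      omega
  have h4 := ((hp.comp h3).mul ((hp.comp h1).inv₀ (euler_ne_zero hQ))).mul
    ((hp.comp h2).inv₀ (euler_ne_zero hQ))
  rw [mul_inv_cancel₀ (euler_ne_zero hQ), one_mul] at h4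
  refine h4.congr' ?_
  filter_upwards [eventually_ge_atTop n.natAbs] with N hN
  have hk : (N + n).toNat ≤ 2 * N := by omega
  have h5 := gaussBinom_mul_poch Q hk
  rw [show 2 * N - (N + n).toNat = (N - n).toNat by omega] at h5
  simp only [Function.comp, tripleCoeff, if_pos hN]
  rw [← h5]
  field_simp [poch_ne_zero hQ (N + n).toNat, poch_ne_zero hQ (N - n).toNat]

lemma prod_eq_tsum_tripleCoeff {q z : ℂ} (hq : q ≠ 0) (hz : z ≠ 0) (N : ℕ) :
    ∏ i ∈ Finset.range N, ((1 + z * q ^ (2 * i + 1)) * (1 + z⁻¹ * q ^ (2 * i + 1))) =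
      ∑' n : ℤ, tripleCoeff (q ^ 2) N n * (q ^ (n ^ 2) * z ^ n) := by
  rw [prod_eq_sum_gaussBinom hq hz, tsum_eq_sum (s := Finset.Icc (-(N : ℤ)) N)]
  · refine Finset.sum_bij' (fun k _ ↦ (k : ℤ) - N) (fun n _ ↦ (N + n).toNat) ?_ ?_ ?_ ?_ ?_
    · intro k hk; rw [Finset.mem_range] at hk; rw [Finset.mem_Icc]; omega
    · intro n hn; rw [Finset.mem_Icc] at hn; rw [Finset.mem_range]; omega
    · intro k hk; omega
    · intro n hn; rw [Finset.mem_Icc] at hn; omega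
    · intro k hk
      rw [Finset.mem_range] at hk
      rw [tripleCoeff, if_pos (by omega)]
      congr 2
      omega
  · intro n hn
    rw [Finset.mem_Icc] at hn
    rw [tripleCoeff, if_neg (by omega), zero_mul]

/-- The Jacobi triple product. -/
theorem hasSum_tripleProduct {q z L : ℂ} (hq : q ≠ 0) (hq1 : ‖q‖ < 1) (hz : z ≠ 0)
    (hs : Summable fun n : ℤ ↦ q ^ (n ^ 2) * z ^ n)
    (hL : Tendsto (fun N ↦ ∏ i ∈ Finset.range N,
      ((1 + z * q ^ (2 * i + 1)) * (1 + z⁻¹ * q ^ (2 * i + 1)))) atTop (𝓝 L)) :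
    HasSum (fun n : ℤ ↦ q ^ (n ^ 2) * z ^ n) (euler (q ^ 2) * L) := by
  have hQ : ‖q ^ 2‖ < 1 := by rw [norm_pow]; exact pow_lt_one₀ (norm_nonneg _) hq1 two_ne_zero
  obtain ⟨C, hC0, hC⟩ := exists_norm_gaussBinom_le hQ
  have hlim : Tendsto (fun N ↦ ∑' n : ℤ, tripleCoeff (q ^ 2) N n * (q ^ (n ^ 2) * z ^ n)) atTop
      (𝓝 (∑' n : ℤ, (euler (q ^ 2))⁻¹ * (q ^ (n ^ 2) * z ^ n))) := by
    refine tendsto_tsum_of_dominated_convergence (bound := fun n ↦ C * ‖q ^ (n ^ 2) * z ^ n‖)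
      (hs.norm.mul_left C) (fun n ↦ (tendsto_tripleCoeff hQ n).mul_const _) ?_
    refine Eventually.of_forall fun N n ↦ ?_
    rw [norm_mul]
    gcongr
    rw [tripleCoeff]
    split_ifs
    · exact hC _ _
    · rwa [norm_zero]
  simp only [← prod_eq_tsum_tripleCoeff hq hz] at hlim
  have h1 := tendsto_nhds_unique hL hlim
  rw [tsum_mul_left] at h1
  have h2 : euler (q ^ 2) * L = ∑' n : ℤ, q ^ (n ^ 2) * z ^ n := by
    rw [h1, mul_inv_cancel_left₀ (euler_ne_zero hQ)]
  rw [h2]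
  exact hs.hasSum

/-! ### Gauss's theta series as eta quotients. -/

lemma norm_pow_lt_one {q : ℂ} (hq : ‖q‖ < 1) {n : ℕ} (hn : n ≠ 0) : ‖q ^ n‖ < 1 := by
  rw [norm_pow]; exact pow_lt_one₀ (norm_nonneg _) hq hn

lemma summable_zpow_sq {q : ℂ} (hq1 : ‖q‖ < 1) :
    Summable fun n : ℤ ↦ q ^ (n ^ 2) := by
  have h1 : ∀ n : ℕ, ‖q ^ ((n : ℤ) ^ 2)‖ ≤ ‖q‖ ^ n := fun n ↦ by
    rw [show ((n : ℤ) ^ 2) = ((n ^ 2 : ℕ) : ℤ) by push_cast; rfl, zpow_natCast, norm_pow]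
    exact pow_le_pow_of_le_one (norm_nonneg _) hq1.le (Nat.le_self_pow two_ne_zero n)
  have hg := summable_geometric_of_lt_one (norm_nonneg q) hq1
  refine Summable.of_nat_of_neg (Summable.of_norm_bounded hg h1) (Summable.of_norm_bounded hg ?_)
  intro n
  rw [neg_sq]
  exact h1 n

lemma summable_zpow_sq_add {q : ℂ} (hq1 : ‖q‖ < 1) :
    Summable fun n : ℤ ↦ q ^ (n ^ 2 + n) := by
  have h1 : ∀ n : ℕ, ‖q ^ ((n : ℤ) ^ 2 + n)‖ ≤ ‖q‖ ^ n := fun n ↦ by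
    rw [show ((n : ℤ) ^ 2 + n) = ((n ^ 2 + n : ℕ) : ℤ) by push_cast; rfl, zpow_natCast, norm_pow]
    exact pow_le_pow_of_le_one (norm_nonneg _) hq1.le (Nat.le_add_left _ _)
  have hg := summable_geometric_of_lt_one (norm_nonneg q) hq1
  refine Summable.of_nat_of_neg_add_one (Summable.of_norm_bounded hg h1)
    (Summable.of_norm_bounded hg ?_)
  intro n
  rw [show (-((n : ℤ) + 1)) ^ 2 + -((n : ℤ) + 1) = (n : ℤ) ^ 2 + n by ring]
  exact h1 n

lemma tendsto_prod_one_add_pow {q : ℂ} (hq : ‖q‖ < 1) :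
    Tendsto (fun N ↦ ∏ i ∈ Finset.range N, (1 + q ^ (i + 1))) atTop
      (𝓝 (euler (q ^ 2) / euler q)) := by
  refine ((tendsto_poch (norm_pow_lt_one hq two_ne_zero)).div (tendsto_poch hq)
    (euler_ne_zero hq)).congr fun N ↦ ?_
  rw [Pi.div_apply, div_eq_iff (poch_ne_zero hq N), poch, poch, ← Finset.prod_mul_distrib]
  exact Finset.prod_congr rfl fun i _ ↦ by ring

lemma tendsto_prod_one_sub_odd {q : ℂ} (hq : ‖q‖ < 1) :
    Tendsto (fun N ↦ ∏ i ∈ Finset.range N, (1 - q ^ (2 * i + 1))) atTop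
      (𝓝 (euler q / euler (q ^ 2))) := by
  have hq2 := norm_pow_lt_one hq two_ne_zero
  have h3 : Tendsto (fun N : ℕ ↦ 2 * N) atTop atTop :=
    tendsto_atTop.mpr fun b ↦ by
      filter_upwards [eventually_ge_atTop b] with N hN
      omega
  refine (((tendsto_poch hq).comp h3).div (tendsto_poch hq2) (euler_ne_zero hq2)).congr fun N ↦ ?_
  rw [Pi.div_apply, div_eq_iff (poch_ne_zero hq2 N), Function.comp, poch, poch,
    ← Finset.prod_mul_distrib]
  induction N with
  | zero => simp
  | succ n ih =>
    rw [Finset.prod_range_succ, ← ih, show 2 * (n + 1) = 2 * n + 1 + 1 by ring,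
      Finset.prod_range_succ, Finset.prod_range_succ]
    ring

lemma tendsto_prod_one_add_odd {q : ℂ} (hq : ‖q‖ < 1) :
    Tendsto (fun N ↦ ∏ i ∈ Finset.range N, (1 + q ^ (2 * i + 1))) atTop
      (𝓝 (euler (q ^ 2) ^ 2 / (euler q * euler (q ^ 4)))) := by
  have hq2 := norm_pow_lt_one hq two_ne_zero
  have h0 := tendsto_prod_one_sub_odd hq
  have h1 := tendsto_prod_one_sub_odd hq2
  rw [← pow_mul] at h1
  have e1 := euler_ne_zero hq
  have e2 := euler_ne_zero hq2
  have h2 := h1.div h0 (div_ne_zero e1 e2)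
  have e4 := euler_ne_zero (norm_pow_lt_one hq (n := 4) (by norm_num))
  rw [show euler (q ^ 2) / euler (q ^ (2 * 2)) / (euler q / euler (q ^ 2)) =
    euler (q ^ 2) ^ 2 / (euler q * euler (q ^ 4)) by norm_num; field_simp] at h2
  refine h2.congr fun N ↦ ?_
  have h5 : ∏ i ∈ Finset.range N, (1 - q ^ (2 * i + 1)) ≠ 0 :=
    Finset.prod_ne_zero_iff.mpr fun _ _ ↦ one_sub_pow_ne_zero hq _
  rw [Pi.div_apply, div_eq_iff h5, ← Finset.prod_mul_distrib]
  exact Finset.prod_congr rfl fun i _ ↦ by ring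

/-- Gauss: `∑ q ^ (n ^ 2)` as an eta quotient. -/
theorem hasSum_zpow_sq {q : ℂ} (hq : q ≠ 0) (hq1 : ‖q‖ < 1) :
    HasSum (fun n : ℤ ↦ q ^ (n ^ 2))
      (euler (q ^ 2) ^ 5 / (euler q ^ 2 * euler (q ^ 4) ^ 2)) := by
  have h := hasSum_tripleProduct hq hq1 one_ne_zero (by simpa using summable_zpow_sq hq1)
    (by simpa [Finset.prod_mul_distrib] using
      (tendsto_prod_one_add_odd hq1).mul (tendsto_prod_one_add_odd hq1))
  simp only [one_zpow, mul_one] at h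
  convert h using 1
  ring

/-- Gauss: `∑ (-1) ^ n q ^ (n ^ 2)` as an eta quotient. -/
theorem hasSum_neg_zpow_sq {q : ℂ} (hq : q ≠ 0) (hq1 : ‖q‖ < 1) :
    HasSum (fun n : ℤ ↦ (-q) ^ (n ^ 2)) (euler q ^ 2 / euler (q ^ 2)) := by
  have hq1' : ‖-q‖ < 1 := by rwa [norm_neg]
  have h2 : ∀ i : ℕ, 1 + (-q) ^ (2 * i + 1) = 1 - q ^ (2 * i + 1) := fun i ↦ by
    rw [Odd.neg_pow ⟨i, rfl⟩, sub_eq_add_neg]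
  have h := hasSum_tripleProduct (neg_ne_zero.mpr hq) hq1' one_ne_zero
    (by simpa using summable_zpow_sq hq1')
    (L := euler q / euler (q ^ 2) * (euler q / euler (q ^ 2)))
    (by simpa [h2, Finset.prod_mul_distrib] using
      (tendsto_prod_one_sub_odd hq1).mul (tendsto_prod_one_sub_odd hq1))
  simp only [one_zpow, mul_one, neg_sq] at h
  convert h using 1
  have e2 := euler_ne_zero (norm_pow_lt_one hq1 two_ne_zero)
  field_simp

/-- Gauss: `∑ q ^ (n ^ 2 + n)` as an eta quotient. -/
theorem hasSum_zpow_sq_add {q : ℂ} (hq : q ≠ 0) (hq1 : ‖q‖ < 1) :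
    HasSum (fun n : ℤ ↦ q ^ (n ^ 2 + n)) (2 * euler (q ^ 4) ^ 2 / euler (q ^ 2)) := by
  have hq2 := norm_pow_lt_one hq1 two_ne_zero
  have e2 := euler_ne_zero hq2
  have h1 := tendsto_prod_one_add_pow hq2
  rw [← pow_mul] at h1
  have h0 : Tendsto (fun N : ℕ ↦ 1 + (q ^ 2) ^ N) atTop (𝓝 (1 + 0)) :=
    tendsto_const_nhds.add (tendsto_pow_atTop_nhds_zero_of_norm_lt_one hq2)
  have hne : ∀ N : ℕ, 1 + (q ^ 2) ^ N ≠ 0 := fun N h ↦ by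
    rcases Nat.eq_zero_or_pos N with rfl | hN
    · norm_num at h
    · have := norm_pow_lt_one hq2 hN.ne'
      rw [eq_neg_of_add_eq_zero_right h, norm_neg, norm_one] at this
      exact lt_irrefl _ this
  -- At z = q the factors in z⁻¹ are 1 + q^(2i). The one at i = 0 equals 2; the others form the
  -- preceding product without its last factor, which tends to 1.
  have h2 : Tendsto (fun N ↦ ∏ i ∈ Finset.range N, (1 + (q ^ 2) ^ i)) atTop
      (𝓝 (2 * (euler (q ^ (2 * 2)) / euler (q ^ 2)) / (1 + 0))) := by
    refine ((h1.const_mul 2).div h0 (by norm_num)).congr fun N ↦ ?_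
    rw [Pi.div_apply, div_eq_iff (hne N), ← Finset.prod_range_succ, Finset.prod_range_succ']
    ring
  have hL : Tendsto (fun N ↦ ∏ i ∈ Finset.range N,
      ((1 + q * q ^ (2 * i + 1)) * (1 + q⁻¹ * q ^ (2 * i + 1)))) atTop
      (𝓝 (euler (q ^ (2 * 2)) / euler (q ^ 2) *
        (2 * (euler (q ^ (2 * 2)) / euler (q ^ 2)) / (1 + 0)))) := by
    refine (h1.mul h2).congr fun N ↦ ?_
    rw [← Finset.prod_mul_distrib]
    refine Finset.prod_congr rfl fun i _ ↦ ?_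
    rw [pow_succ q (2 * i), mul_comm (q ^ (2 * i)) q, inv_mul_cancel_left₀ hq]
    ring
  have hcomb : ∀ n : ℤ, q ^ (n ^ 2) * q ^ n = q ^ (n ^ 2 + n) := fun n ↦ (zpow_add₀ hq _ _).symm
  have h := hasSum_tripleProduct hq hq1 hq (by simpa only [hcomb] using summable_zpow_sq_add hq1) hL
  simp only [hcomb] at h
  convert h using 1
  norm_num
  field_simp

/-! ### Dissection of theta series and the relations between φ(q) and φ(-q). -/

lemma HasSum.int_even_add_odd {f : ℤ → ℂ} {s t : ℂ} (hs : HasSum (fun n ↦ f (2 * n)) s)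
    (ht : HasSum (fun n ↦ f (2 * n + 1)) t) : HasSum f (s + t) := by
  have i1 : Function.Injective fun n : ℤ ↦ 2 * n := fun a b h ↦ by
    simp only at h; omega
  have i2 : Function.Injective fun n : ℤ ↦ 2 * n + 1 := fun a b h ↦ by
    simp only at h; omega
  have hc : IsCompl (Set.range fun n : ℤ ↦ 2 * n) (Set.range fun n : ℤ ↦ 2 * n + 1) := by
    have h1 : (Set.range fun n : ℤ ↦ 2 * n) = {n | Even n} :=
      Set.ext fun n ↦ ⟨fun ⟨k, h⟩ ↦ h ▸ even_two_mul k, fun ⟨k, h⟩ ↦ ⟨k, by simp only; omega⟩⟩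
    have h2 : (Set.range fun n : ℤ ↦ 2 * n + 1) = {n | Odd n} :=
      Set.ext fun n ↦ ⟨fun ⟨k, h⟩ ↦ ⟨k, h.symm⟩, fun ⟨k, h⟩ ↦ ⟨k, h.symm⟩⟩
    rw [h1, h2]
    exact Int.isCompl_even_odd
  exact HasSum.add_isCompl hc (i1.hasSum_range_iff.2 hs) (i2.hasSum_range_iff.2 ht)

/-- Even and odd parts of `∑ q ^ (n ^ 2)`. -/
lemma theta_split {q s t u : ℂ} (hq : q ≠ 0) (hs : HasSum (fun n : ℤ ↦ q ^ (n ^ 2)) s)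
    (ht : HasSum (fun n : ℤ ↦ (q ^ 4) ^ (n ^ 2)) t)
    (hu : HasSum (fun n : ℤ ↦ (q ^ 4) ^ (n ^ 2 + n)) u) : s = t + q * u := by
  refine hs.unique (HasSum.int_even_add_odd ?_ ?_)
  · refine ht.congr_fun fun n ↦ ?_
    rw [← zpow_natCast, ← zpow_mul]
    congr 1; push_cast; ring
  · refine (hu.mul_left q).congr_fun fun n ↦ ?_
    rw [← zpow_natCast, ← zpow_mul, ← zpow_one_add₀ hq]
    congr 1; push_cast; ring

lemma euler_zero : euler 0 = 1 := by simp [euler]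

/-- The eta quotient `∏ (1 - q ^ n) ^ 2 / (1 - q ^ (2 * n))`, which is `∑ (-1) ^ n q ^ (n ^ 2)`. -/
noncomputable def thetaNeg (q : ℂ) : ℂ := euler q ^ 2 / euler (q ^ 2)

lemma thetaNeg_ne_zero {q : ℂ} (hq : ‖q‖ < 1) : thetaNeg q ≠ 0 :=
  div_ne_zero (pow_ne_zero _ (euler_ne_zero hq)) (euler_ne_zero (norm_pow_lt_one hq two_ne_zero))

/-- For q ≠ 0 both sides sum the series ∑ q^(n²): one by Gauss's alternating formula at -q, the
other by the plain one. -/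
lemma thetaNeg_neg {q : ℂ} (hq : ‖q‖ < 1) :
    thetaNeg (-q) = euler (q ^ 2) ^ 5 / (euler q ^ 2 * euler (q ^ 4) ^ 2) := by
  rcases eq_or_ne q 0 with rfl | h0
  · simp [thetaNeg, euler_zero]
  · have h := hasSum_neg_zpow_sq (neg_ne_zero.mpr h0) (by rwa [norm_neg])
    rw [neg_neg] at h
    exact h.unique (hasSum_zpow_sq h0 hq)

lemma thetaNeg_neg_eq_add {q : ℂ} (hq : ‖q‖ < 1) :
    thetaNeg (-q) = thetaNeg (-(q ^ 4)) + q * (2 * euler (q ^ 16) ^ 2 / euler (q ^ 8)) := by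
  rcases eq_or_ne q 0 with rfl | h0
  · simp
  · have hq4 := norm_pow_lt_one hq (n := 4) (by norm_num)
    have h4 := pow_ne_zero 4 h0
    rw [thetaNeg_neg hq, thetaNeg_neg hq4]
    have h := theta_split h0 (hasSum_zpow_sq h0 hq) (hasSum_zpow_sq h4 hq4)
      (hasSum_zpow_sq_add h4 hq4)
    simpa only [← pow_mul, Nat.reduceMul] using h

lemma thetaNeg_eq_sub {q : ℂ} (hq : ‖q‖ < 1) :
    thetaNeg q = thetaNeg (-(q ^ 4)) - q * (2 * euler (q ^ 16) ^ 2 / euler (q ^ 8)) := by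
  have h := thetaNeg_neg_eq_add (q := -q) (by rwa [norm_neg])
  rw [neg_neg, Even.neg_pow (by decide), Even.neg_pow (by decide), Even.neg_pow (by decide)] at h
  rw [h]; ring

lemma thetaNeg_neg_add_thetaNeg {q : ℂ} (hq : ‖q‖ < 1) :
    thetaNeg (-q) + thetaNeg q = 2 * thetaNeg (-((q ^ 2) ^ 2)) := by
  rw [thetaNeg_neg_eq_add hq, thetaNeg_eq_sub hq]
  ring_nf

lemma thetaNeg_mul_thetaNeg_neg {q : ℂ} (hq : ‖q‖ < 1) :
    thetaNeg (-q) * thetaNeg q = thetaNeg (q ^ 2) ^ 2 := by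
  have e1 := euler_ne_zero hq
  have e2 := euler_ne_zero (norm_pow_lt_one hq (n := 2) (by norm_num))
  have e4 := euler_ne_zero (norm_pow_lt_one hq (n := 4) (by norm_num))
  rw [thetaNeg_neg hq, thetaNeg, thetaNeg, ← pow_mul]
  norm_num only
  field_simp

/-- Write φ(±q) = a ± b and φ(±q²) = c ± d by the even-odd dissection. Then a² - b² = (c - d)² and
b² = 2cd, so 2a² + 2b² = 2(c - d)² + 8cd = 2(c + d)². -/
lemma thetaNeg_neg_sq_add_sq {q : ℂ} (hq : ‖q‖ < 1) :
    thetaNeg (-q) ^ 2 + thetaNeg q ^ 2 = 2 * thetaNeg (-(q ^ 2)) ^ 2 := by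
  have h2 := norm_pow_lt_one hq (n := 2) (by norm_num)
  have h8 := norm_pow_lt_one hq (n := 8) (by norm_num)
  have e8 := euler_ne_zero h8
  have e16 := euler_ne_zero (norm_pow_lt_one hq (n := 16) (by norm_num))
  have e32 := euler_ne_zero (norm_pow_lt_one hq (n := 32) (by norm_num))
  have h := thetaNeg_mul_thetaNeg_neg hq
  have k1 := thetaNeg_neg_eq_add h2
  have k2 := thetaNeg_eq_sub h2
  simp only [← pow_mul, Nat.reduceMul] at k1 k2
  have k3 : (q * (2 * euler (q ^ 16) ^ 2 / euler (q ^ 8))) ^ 2 = 2 * thetaNeg (-(q ^ 8)) *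
      (q ^ 2 * (2 * euler (q ^ 32) ^ 2 / euler (q ^ 16))) := by
    rw [thetaNeg_neg h8]
    simp only [← pow_mul, Nat.reduceMul]
    field_simp
  rw [thetaNeg_neg_eq_add hq, thetaNeg_eq_sub hq] at h ⊢
  rw [k2] at h
  rw [k1]
  linear_combination 2 * h + 4 * k3

/-- `g₈` as a function of `q`. -/
noncomputable def eulerG8 (q : ℂ) : ℂ :=
  q * (euler (q ^ 8) ^ 4 * euler (q ^ 2) ^ 2 / (euler (q ^ 4) ^ 2 * euler q ^ 4))

/-- `g₂` as a function of `q`. -/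
noncomputable def eulerG2 (q : ℂ) : ℂ := q * (euler (q ^ 2) / euler q) ^ 24

/-- With φ(±q) = a ± b the left side is 4ab, and both a and b are eta quotients. -/
lemma thetaNeg_neg_sq_sub_sq {q : ℂ} (hq : ‖q‖ < 1) :
    thetaNeg (-q) ^ 2 - thetaNeg q ^ 2 = 8 * q * (euler (q ^ 8) ^ 4 / euler (q ^ 4) ^ 2) := by
  have h4 := norm_pow_lt_one hq (n := 4) (by norm_num)
  have e4 := euler_ne_zero h4
  have e8 := euler_ne_zero (norm_pow_lt_one hq (n := 8) (by norm_num))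
  have e16 := euler_ne_zero (norm_pow_lt_one hq (n := 16) (by norm_num))
  rw [thetaNeg_neg_eq_add hq, thetaNeg_eq_sub hq, thetaNeg_neg h4]
  simp only [← pow_mul, Nat.reduceMul]
  field_simp
  ring

lemma eight_mul_eulerG8 {q : ℂ} (hq : ‖q‖ < 1) :
    8 * eulerG8 q * thetaNeg q ^ 2 = thetaNeg (-q) ^ 2 - thetaNeg q ^ 2 := by
  have e1 := euler_ne_zero hq
  have e2 := euler_ne_zero (norm_pow_lt_one hq (n := 2) (by norm_num))
  have e4 := euler_ne_zero (norm_pow_lt_one hq (n := 4) (by norm_num))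
  rw [thetaNeg_neg_sq_sub_sq hq, eulerG8, thetaNeg]
  field_simp

lemma sixteen_mul_eulerG2 {q : ℂ} (hq : ‖q‖ < 1) :
    16 * eulerG2 q * thetaNeg q ^ 8 =
      (thetaNeg (-q) ^ 4 - thetaNeg q ^ 4) * thetaNeg (-q) ^ 4 := by
  have h2 := norm_pow_lt_one hq (n := 2) (by norm_num)
  have e1 := euler_ne_zero hq
  have e2 := euler_ne_zero h2
  have e4 := euler_ne_zero (norm_pow_lt_one hq (n := 4) (by norm_num))
  have e8 := euler_ne_zero (norm_pow_lt_one hq (n := 8) (by norm_num))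
  have h : thetaNeg (-q) ^ 4 - thetaNeg q ^ 4 =
      16 * q * (euler (q ^ 4) ^ 8 / euler (q ^ 2) ^ 4) := by
    rw [show thetaNeg (-q) ^ 4 - thetaNeg q ^ 4 = (thetaNeg (-q) ^ 2 - thetaNeg q ^ 2) *
      (thetaNeg (-q) ^ 2 + thetaNeg q ^ 2) by ring, thetaNeg_neg_sq_add_sq hq,
      thetaNeg_neg_sq_sub_sq hq, thetaNeg_neg h2]
    simp only [← pow_mul, Nat.reduceMul]
    field_simp
    ring
  rw [h, thetaNeg_neg hq, eulerG2, thetaNeg]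
  field_simp

/-! ### Taylor series on the unit disc and q-expansions. -/

/-- `P` is the Taylor series of `f` on the open unit disc. -/
def IsTaylorOnDisc (f : ℂ → ℂ) (P : PowerSeries ℂ) : Prop :=
  ∀ q : ℂ, ‖q‖ < 1 → HasSum (fun n ↦ PowerSeries.coeff n P * q ^ n) (f q)

namespace IsTaylorOnDisc

variable {f g : ℂ → ℂ} {P R : PowerSeries ℂ}

lemma exists_of_differentiableOn (hf : DifferentiableOn ℂ f (Metric.ball 0 1)) :
    ∃ P, IsTaylorOnDisc f P := by
  refine ⟨PowerSeries.mk fun n ↦ (n.factorial : ℂ)⁻¹ * iteratedDeriv n f 0, fun q hq ↦ ?_⟩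
  have h := Complex.hasSum_taylorSeries_on_ball (r := 1) (c := 0) (z := q) (by simpa using hf)
    (by simpa using hq)
  refine h.congr_fun fun n ↦ ?_
  simp only [PowerSeries.coeff_mk, sub_zero, smul_eq_mul]
  ring

lemma congr_of_eqOn (hf : IsTaylorOnDisc f P) (h : ∀ q, ‖q‖ < 1 → g q = f q) :
    IsTaylorOnDisc g P := fun q hq ↦ h q hq ▸ hf q hq

lemma add (hf : IsTaylorOnDisc f P) (hg : IsTaylorOnDisc g R) :
    IsTaylorOnDisc (fun q ↦ f q + g q) (P + R) := fun q hq ↦ by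
  simpa [add_mul] using (hf q hq).add (hg q hq)

lemma const (c : ℂ) : IsTaylorOnDisc (fun _ ↦ c) (PowerSeries.C c) := fun q _ ↦ by
  convert hasSum_single (f := fun n ↦ PowerSeries.coeff n (PowerSeries.C c) * q ^ n) 0 ?_ using 1
  · simp
  · intro n hn
    simp [PowerSeries.coeff_C, hn]

lemma mul (hf : IsTaylorOnDisc f P) (hg : IsTaylorOnDisc g R) :
    IsTaylorOnDisc (fun q ↦ f q * g q) (P * R) := fun q hq ↦ by
  have h1 := (hf q hq).summable.norm
  have h2 := (hg q hq).summable.norm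
  have h3 := (summable_norm_sum_mul_antidiagonal_of_summable_norm h1 h2).of_norm
  have h4 := tsum_mul_tsum_eq_tsum_sum_antidiagonal_of_summable_norm h1 h2
  rw [(hf q hq).tsum_eq, (hg q hq).tsum_eq] at h4
  change HasSum _ (f q * g q)
  rw [h4]
  refine h3.hasSum.congr_fun fun n ↦ ?_
  rw [PowerSeries.coeff_mul, Finset.sum_mul]
  refine Finset.sum_congr rfl fun x hx ↦ ?_
  rw [← Finset.HasAntidiagonal.mem_antidiagonal.mp hx, pow_add]
  ring

lemma pow (hf : IsTaylorOnDisc f P) (n : ℕ) : IsTaylorOnDisc (fun q ↦ f q ^ n) (P ^ n) := by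
  induction n with
  | zero => simpa using const 1
  | succ n ih => simpa only [pow_succ] using ih.mul hf

lemma atNeg (hf : IsTaylorOnDisc f P) :
    IsTaylorOnDisc (fun q ↦ f (-q)) (OverpartitionU.atNeg P) := fun q hq ↦ by
  refine (hf (-q) (by rwa [norm_neg])).congr_fun fun n ↦ ?_
  rw [OverpartitionU.atNeg, PowerSeries.coeff_rescale, neg_pow q]
  ring

lemma atSq (hf : IsTaylorOnDisc f P) :
    IsTaylorOnDisc (fun q ↦ f (q ^ 2)) (OverpartitionU.atSq P) := fun q hq ↦ by
  have h := hf (q ^ 2) (norm_pow_lt_one hq two_ne_zero)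
  have hi : Function.Injective fun n : ℕ ↦ 2 * n := mul_right_injective₀ two_ne_zero
  rw [← hi.hasSum_iff]
  · refine h.congr_fun fun n ↦ ?_
    simp [OverpartitionU.atSq, pow_mul]
  · intro n hn
    rw [OverpartitionU.atSq, PowerSeries.coeff_expand_of_not_dvd, zero_mul]
    rintro ⟨k, rfl⟩
    exact hn ⟨k, rfl⟩

lemma hasFPowerSeriesOnBall (hf : IsTaylorOnDisc f P) :
    HasFPowerSeriesOnBall f (.ofScalars ℂ fun n ↦ PowerSeries.coeff n P) 0 1 := by
  refine ⟨?_, one_pos, ?_⟩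
  · refine ENNReal.le_of_forall_nnreal_lt fun r hr ↦ ?_
    refine FormalMultilinearSeries.le_radius_of_summable_norm _ ?_
    have h := (hf (r : ℂ) (by simpa using hr)).summable.norm
    simpa using h
  · intro q hq
    have h := hf q (by
      simpa [enorm_eq_nnnorm, ← NNReal.coe_lt_coe] using hq)
    rw [zero_add]
    refine h.congr_fun fun n ↦ ?_
    simp [mul_comm]

/-- The transfer principle: an identity of functions on the disc becomes one of formal series. -/
lemma unique (hf : IsTaylorOnDisc f P) (hg : IsTaylorOnDisc g R)
    (h : ∀ q, ‖q‖ < 1 → f q = g q) : P = R := by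
  have h1 := (hf.congr_of_eqOn fun q hq ↦ (h q hq).symm).hasFPowerSeriesOnBall.hasFPowerSeriesAt
  have h2 := h1.eq_formalMultilinearSeries hg.hasFPowerSeriesOnBall.hasFPowerSeriesAt
  ext n
  simpa using congr_arg (FormalMultilinearSeries.coeff · n) h2

lemma cuspFunction_eq {F : ℍ → ℂ} (hF : ∀ τ : ℍ, F τ = f (Function.Periodic.qParam 1 τ)) {q : ℂ}
    (hq : ‖q‖ < 1) (h0 : q ≠ 0) : UpperHalfPlane.cuspFunction 1 F q = f q := by
  have him := Function.Periodic.im_invQParam_pos_of_norm_lt_one one_pos hq h0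
  rw [UpperHalfPlane.cuspFunction, Function.Periodic.cuspFunction_eq_of_nonzero _ _ h0,
    Function.comp_apply, UpperHalfPlane.ofComplex_apply_of_im_pos him, hF,
    UpperHalfPlane.coe_mk, Function.Periodic.qParam_right_inv one_ne_zero h0]

lemma cuspFunction_eventuallyEq (hf : IsTaylorOnDisc f P) {F : ℍ → ℂ}
    (hF : ∀ τ : ℍ, F τ = f (Function.Periodic.qParam 1 τ)) :
    f =ᶠ[𝓝 0] UpperHalfPlane.cuspFunction 1 F := by
  have hcont : ContinuousAt f 0 := hf.hasFPowerSeriesOnBall.analyticAt.continuousAt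
  have hev : UpperHalfPlane.cuspFunction 1 F =ᶠ[𝓝[≠] 0] f := by
    filter_upwards [self_mem_nhdsWithin, nhdsWithin_le_nhds (Metric.ball_mem_nhds 0 one_pos)]
      with q h0 hq
    exact cuspFunction_eq hF (by simpa using hq) h0
  -- The cusp function takes at 0 its limit along nonzero q, which continuity of `f` identifies.
  have hzero : UpperHalfPlane.cuspFunction 1 F 0 = f 0 := by
    have h1 : Tendsto (UpperHalfPlane.cuspFunction 1 F) (𝓝[≠] 0) (𝓝 (f 0)) :=
      (hcont.tendsto.mono_left nhdsWithin_le_nhds).congr' hev.symm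
    rw [UpperHalfPlane.cuspFunction] at h1 ⊢
    rw [Function.Periodic.cuspFunction_zero_eq_limUnder_nhds_ne]
    exact h1.limUnder_eq
  refine (eventually_nhdsWithin_iff.mp hev).mono fun q h ↦ ?_
  rcases eq_or_ne q 0 with rfl | h0
  exacts [hzero.symm, (h h0).symm]

lemma qExpansion_eq (hf : IsTaylorOnDisc f P) {F : ℍ → ℂ}
    (hF : ∀ τ : ℍ, F τ = f (Function.Periodic.qParam 1 τ)) :
    UpperHalfPlane.qExpansion 1 F = P := by
  have h1 := hf.hasFPowerSeriesOnBall.hasFPowerSeriesAt.congr (hf.cuspFunction_eventuallyEq hF)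
  have h2 := h1.eq_formalMultilinearSeries h1.analyticAt.hasFPowerSeriesAt
  ext m
  rw [UpperHalfPlane.qExpansion_coeff]
  simpa [div_eq_inv_mul] using (congr_arg (FormalMultilinearSeries.coeff · m) h2).symm

end IsTaylorOnDisc

/-! ### The 2-adic grading on integer polynomials. -/

open Polynomial in
/-- Integer polynomials whose coefficient of `X ^ r` is divisible by `2 ^ (2 * r - s)` and vanishes
when `2 * r < s`. -/
def IsGraded (s : ℕ) (P : ℤ[X]) : Prop :=
  ∀ r, 4 ^ r ∣ 2 ^ s * P.coeff r ∧ (P.coeff r ≠ 0 → s ≤ 2 * r)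

namespace IsGraded

open Polynomial

variable {s t : ℕ} {P Q : ℤ[X]}

lemma add (hP : IsGraded s P) (hQ : IsGraded s Q) : IsGraded s (P + Q) := fun r ↦ by
  refine ⟨by rw [coeff_add, mul_add]; exact dvd_add (hP r).1 (hQ r).1, fun h ↦ ?_⟩
  by_contra hlt
  exact h (by rw [coeff_add, not_not.mp (mt (hP r).2 hlt), not_not.mp (mt (hQ r).2 hlt), add_zero])

lemma mul (hP : IsGraded s P) (hQ : IsGraded t Q) : IsGraded (s + t) (P * Q) := fun r ↦ by
  rw [coeff_mul]
  constructor
  · rw [Finset.mul_sum]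
    refine Finset.dvd_sum fun x hx ↦ ?_
    rw [← Finset.HasAntidiagonal.mem_antidiagonal.mp hx, pow_add, pow_add, mul_mul_mul_comm]
    exact mul_dvd_mul (hP _).1 (hQ _).1
  · intro h
    obtain ⟨x, hx, hne⟩ := Finset.exists_ne_zero_of_sum_ne_zero h
    have h1 := (hP _).2 (left_ne_zero_of_mul hne)
    have h2 := (hQ _).2 (right_ne_zero_of_mul hne)
    have h3 := Finset.HasAntidiagonal.mem_antidiagonal.mp hx
    omega

lemma const (c : ℤ) : IsGraded 0 (C c) := fun r ↦ by
  rcases Nat.eq_zero_or_pos r with rfl | h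
  · simp
  · rw [coeff_C, if_neg h.ne']
    simp

lemma X : IsGraded 2 (X : ℤ[X]) := fun r ↦ by
  rcases eq_or_ne r 1 with rfl | h
  · simp
  · simp [coeff_X, h.symm]

lemma four_mul_X : IsGraded 0 (4 * Polynomial.X : ℤ[X]) := fun r ↦ by
  rw [show (4 : ℤ[X]) = C 4 from rfl, coeff_C_mul]
  rcases eq_or_ne r 1 with rfl | h
  · simp
  · simp [coeff_X, h.symm]

/-- A factor 2 buys one unit of weight. -/
lemma two_mul (hP : IsGraded (s + 1) P) : IsGraded s (2 * P) := fun r ↦ by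
  rw [show (2 : ℤ[X]) = C 2 from rfl, coeff_C_mul]
  refine ⟨?_, fun h ↦ ?_⟩
  · rw [← mul_assoc, ← pow_succ]; exact (hP r).1
  · have := (hP r).2 (right_ne_zero_of_mul h)
    omega

lemma pow (hP : IsGraded 0 P) (n : ℕ) : IsGraded 0 (P ^ n) := by
  induction n with
  | zero => simpa using const 1
  | succ n ih => rw [pow_succ]; exact ih.mul hP

end IsGraded

open Polynomial

/-! ### The recurrence for the polynomials in G₈. -/

/-- The polynomial `X (1 + 4 X) (1 + 8 X) ^ 2`. -/
noncomputable def normPoly : ℤ[X] := X * ((C 1 + 4 * X) * (C 1 + C 2 * (4 * X)) ^ 2)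

lemma isGraded_normPoly : IsGraded 2 normPoly := by
  have h := IsGraded.four_mul_X
  exact IsGraded.X.mul (((IsGraded.const 1).add h).mul
    (((IsGraded.const 1).add ((IsGraded.const 2).mul h)).pow 2))

/-- The polynomial `16 Z (3 + 256 Z)`, where `Z` is `normPoly`. -/
noncomputable def tracePoly : ℤ[X] :=
  -- The factors 2 are kept apart for the grading: two of them bring `normPoly` from weight 2 to 0
  -- inside the bracket, and the outer one brings the product from 2 to 1.
  2 * (normPoly * (C 24 + C 256 * (2 * (2 * (C 2 * normPoly)))))

lemma isGraded_tracePoly : IsGraded 1 tracePoly := by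
  have h : IsGraded 2 (C 2 * normPoly) := (IsGraded.const 2).mul isGraded_normPoly
  exact (isGraded_normPoly.mul ((IsGraded.const 24).add
    ((IsGraded.const 256).mul h.two_mul.two_mul))).two_mul

/-- The polynomial in `g₈` attached to `s = 1`. -/
noncomputable def atkinPolyOne : ℤ[X] :=
  -- These coefficients come from expanding (u⁸ + v⁸ - u⁴ - v⁴ + u⁹ + v⁹ - u⁵ - v⁵)/64 in y, where
  -- uv = 1 and u + v = 2 + 16y. Written in 4X, the inner factor visibly has weight 0.
  2 * (X * (C 13 + C 403 * (4 * X) + C 4030 * (4 * X) ^ 2 + C 19448 * (4 * X) ^ 3 +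
    C 52416 * (4 * X) ^ 4 + C 83200 * (4 * X) ^ 5 + C 77312 * (4 * X) ^ 6 +
    C 38912 * (4 * X) ^ 7 + C 8192 * (4 * X) ^ 8))

lemma isGraded_atkinPolyOne : IsGraded 1 atkinPolyOne := by
  have h (c : ℤ) (n : ℕ) : IsGraded 0 (C c * (4 * X) ^ n) :=
    (IsGraded.const c).mul (IsGraded.four_mul_X.pow n)
  refine (IsGraded.X.mul (t := 0) ?_).two_mul
  refine ((((((((IsGraded.const 13).add ?_).add (h _ 2)).add (h _ 3)).add (h _ 4)).add
    (h _ 5)).add (h _ 6)).add (h _ 7)).add (h _ 8)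
  exact (IsGraded.const 403).mul IsGraded.four_mul_X

/-- The polynomial `P` with `(Φ₂(-q) G₂(-q) ^ s) | U₂ = Φ₂(-q²) P(G₈(q))`. -/
noncomputable def atkinPoly : ℕ → ℤ[X]
  | 0 => C 1 + 4 * X
  | 1 => atkinPolyOne
  | s + 2 => tracePoly * atkinPoly (s + 1) + normPoly * atkinPoly s

lemma isGraded_atkinPoly (s : ℕ) : IsGraded s (atkinPoly s) := by
  induction s using Nat.twoStepInduction with
  | zero => exact (IsGraded.const 1).add IsGraded.four_mul_X
  | one => exact isGraded_atkinPolyOne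
  | more s h0 h1 =>
    have h2 := isGraded_tracePoly.mul h1
    have h3 := isGraded_normPoly.mul h0
    rw [show 1 + (s + 1) = s + 2 by ring] at h2
    rw [add_comm 2] at h3
    exact h2.add h3

lemma natDegree_normPoly_le : normPoly.natDegree ≤ 4 := by
  rw [normPoly]; compute_degree

lemma natDegree_tracePoly_le : tracePoly.natDegree ≤ 8 := by
  have h := natDegree_normPoly_le
  rw [tracePoly]
  generalize normPoly = Z at h
  have h1 : (C 24 + C 256 * (2 * (2 * (C 2 * Z)))).natDegree ≤ 4 := by
    compute_degree
    exact h
  refine natDegree_mul_le_of_le (m := 0) (n := 8) (by compute_degree) ?_ |>.trans (by norm_num)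
  exact natDegree_mul_le_of_le h h1

lemma natDegree_atkinPoly_le (s : ℕ) : (atkinPoly s).natDegree ≤ 8 * s + 1 := by
  induction s using Nat.twoStepInduction with
  | zero => rw [atkinPoly]; compute_degree
  | one => rw [atkinPoly, atkinPolyOne]; compute_degree
  | more s h0 h1 =>
    rw [atkinPoly]
    refine natDegree_add_le_of_degree_le
      ((natDegree_mul_le_of_le natDegree_tracePoly_le h1).trans (by omega))
      ((natDegree_mul_le_of_le natDegree_normPoly_le h0).trans (by omega))

/-- Power sums of u and v are polynomials in u + v because uv = 1; this settles s = 0, s = 1, g + h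
and gh. The induction then uses g^(s+2) = (g + h)g^(s+1) - gh g^s and its analogue for h.
Characteristic zero and the absence of zero divisors allow cancelling 16 and 256. -/
lemma eval₂_atkinPoly {R : Type*} [CommRing R] [IsDomain R] [CharZero R] {u v y g h : R}
    (huv : u * v = 1) (hy : 16 * y = u + v - 2) (hg : 16 * g = (u ^ 4 - 1) * u ^ 4)
    (hh : 16 * h = (v ^ 4 - 1) * v ^ 4) (s : ℕ) :
    (1 + u) * g ^ s + (1 + v) * h ^ s = 4 * eval₂ (Int.castRingHom R) y (atkinPoly s) := by
  have sq {a b c : R} (hab : a * b = 1) (hc : a + b = c) : a ^ 2 + b ^ 2 = c ^ 2 - 2 := by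
    linear_combination (a + b + c) * hc - 2 * hab
  have huv2 : u ^ 2 * v ^ 2 = 1 := by rw [← mul_pow, huv, one_pow]
  have huv3 : u ^ 3 * v ^ 3 = 1 := by rw [← mul_pow, huv, one_pow]
  have huv4 : u ^ 4 * v ^ 4 = 1 := by rw [← mul_pow, huv, one_pow]
  have c1 : u + v = 2 + 16 * y := by linear_combination -hy
  have c2 := sq huv c1
  have c4 := sq huv2 c2
  have c8 := sq (a := u ^ 4) (b := v ^ 4) huv4 (by simpa only [← pow_mul] using c4)
  simp only [← pow_mul, Nat.reduceMul] at c4 c8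
  have c3 : u ^ 3 + v ^ 3 = (u + v) * (u ^ 2 + v ^ 2) - (u + v) := by
    linear_combination -(u + v) * huv
  have c5 : u ^ 5 + v ^ 5 = (u + v) * (u ^ 4 + v ^ 4) - (u ^ 3 + v ^ 3) := by
    linear_combination -(u ^ 3 + v ^ 3) * huv
  have c9 : u ^ 9 + v ^ 9 = (u ^ 4 + v ^ 4) * (u ^ 5 + v ^ 5) - (u + v) := by
    linear_combination -(u + v) * huv4
  rw [c1, c2] at c3
  rw [c1, c3, c4] at c5
  rw [c4, c5, c1] at c9
  have h256 : (256 : R) ≠ 0 := by norm_num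
  have h16 : (16 : R) ≠ 0 := by norm_num
  have hnorm : eval₂ (Int.castRingHom R) y normPoly = y * ((1 + 4 * y) * (1 + 8 * y) ^ 2) := by
    simp only [normPoly, map_one, map_ofNat, eval₂_mul, eval₂_add,
      eval₂_pow, eval₂_X, eval₂_one, eval₂_ofNat]
    ring
  have hprod : g * h = -eval₂ (Int.castRingHom R) y normPoly := by
    apply mul_left_cancel₀ h256
    rw [hnorm]
    linear_combination 16 * h * hg + (u ^ 4 - 1) * u ^ 4 * hh +
      ((u ^ 4 - 1) * (v ^ 4 - 1) + 1) * huv4 - c4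
  have hsum : g + h = eval₂ (Int.castRingHom R) y tracePoly := by
    apply mul_left_cancel₀ h16
    simp only [tracePoly, hnorm, map_ofNat, eval₂_mul, eval₂_add,
      eval₂_ofNat]
    linear_combination hg + hh + c8 - c4
  induction s using Nat.twoStepInduction with
  | zero =>
    simp only [atkinPoly, pow_zero, map_one, eval₂_mul, eval₂_add,
      eval₂_X, eval₂_one, eval₂_ofNat]
    linear_combination c1
  | one =>
    apply mul_left_cancel₀ h16
    simp only [atkinPoly, atkinPolyOne, map_ofNat, eval₂_mul, eval₂_add,
      eval₂_pow, eval₂_X, eval₂_ofNat]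
    linear_combination (1 + u) * hg + (1 + v) * hh + c8 - c4 + c9 - c5
  | more s h0 h1 =>
    rw [atkinPoly, eval₂_add, eval₂_mul, eval₂_mul, ← hsum]
    have hprod' : eval₂ (Int.castRingHom R) y normPoly = -(g * h) := by rw [hprod, neg_neg]
    rw [hprod']
    linear_combination (g + h) * h1 - g * h * h0

/-! ### The eta quotients as functions of q and their Taylor series. -/

lemma eta_natCast_mul (k : ℕ) (τ : ℍ) : η (k * (τ : ℂ)) =
    Function.Periodic.qParam 24 τ ^ k * euler (Function.Periodic.qParam 1 τ ^ k) := by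
  have h (x : ℝ) : Function.Periodic.qParam x (k * (τ : ℂ)) = Function.Periodic.qParam x τ ^ k := by
    rw [Function.Periodic.qParam, Function.Periodic.qParam, ← Complex.exp_nat_mul]
    congr 1; ring
  rw [ModularForm.eta, euler]
  simp only [ModularForm.eta_q, h]

lemma eta_eq (τ : ℍ) : η (τ : ℂ) =
    Function.Periodic.qParam 24 τ * euler (Function.Periodic.qParam 1 τ) := by
  simpa using eta_natCast_mul 1 τ

lemma qParam_pow_twentyfour (τ : ℍ) :
    Function.Periodic.qParam 24 τ ^ 24 = Function.Periodic.qParam 1 τ := by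
  rw [Function.Periodic.qParam, Function.Periodic.qParam, ← Complex.exp_nat_mul]
  congr 1
  push_cast
  ring

lemma norm_qParam_lt_one (τ : ℍ) : ‖Function.Periodic.qParam 1 τ‖ < 1 :=
  Function.Periodic.norm_qParam_lt_one one_pos τ.im_pos

lemma phi2_eq (τ : ℍ) : phi2 τ = (thetaNeg (Function.Periodic.qParam 1 τ))⁻¹ := by
  have hx : Function.Periodic.qParam 24 τ ≠ 0 := Function.Periodic.qParam_ne_zero _
  have e1 := euler_ne_zero (norm_qParam_lt_one τ)
  have h2 := eta_natCast_mul 2 τ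
  push_cast at h2
  rw [phi2, h2, eta_eq, thetaNeg]
  field_simp

lemma g2_eq (τ : ℍ) : g2 τ = eulerG2 (Function.Periodic.qParam 1 τ) := by
  have hx : Function.Periodic.qParam 24 τ ≠ 0 := Function.Periodic.qParam_ne_zero _
  have e1 := euler_ne_zero (norm_qParam_lt_one τ)
  have h2 := eta_natCast_mul 2 τ
  push_cast at h2
  rw [g2, h2, eta_eq, eulerG2]
  nth_rewrite 3 [← qParam_pow_twentyfour]
  rw [← mul_pow]
  congr 1
  field_simp

lemma g8_eq (τ : ℍ) : g8 τ = eulerG8 (Function.Periodic.qParam 1 τ) := by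
  have hx : Function.Periodic.qParam 24 τ ≠ 0 := Function.Periodic.qParam_ne_zero _
  have hq := norm_qParam_lt_one τ
  have e1 := euler_ne_zero hq
  have e4 := euler_ne_zero (norm_pow_lt_one hq (n := 4) (by norm_num))
  have h2 := eta_natCast_mul 2 τ
  have h4 := eta_natCast_mul 4 τ
  have h8 := eta_natCast_mul 8 τ
  push_cast at h2 h4 h8
  have h24 := qParam_pow_twentyfour τ
  rw [g8, h2, h4, h8, eta_eq, eulerG8]
  generalize Function.Periodic.qParam 24 τ = x at *
  generalize Function.Periodic.qParam 1 τ = q at *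
  generalize euler (q ^ 8) = E8
  generalize euler (q ^ 2) = E2
  generalize euler (q ^ 4) = E4 at *
  generalize euler q = E1 at *
  subst h24
  field_simp

lemma differentiableOn_euler_pow {k : ℕ} (hk : k ≠ 0) :
    DifferentiableOn ℂ (fun q ↦ euler (q ^ k)) (Metric.ball 0 1) :=
  ModularForm.differentiableOn_tprod_one_sub_pow.comp (by fun_prop) fun q hq ↦ by
    simpa using norm_pow_lt_one (mem_ball_zero_iff.mp hq) hk

lemma differentiableOn_euler : DifferentiableOn ℂ euler (Metric.ball 0 1) :=
  ModularForm.differentiableOn_tprod_one_sub_pow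

lemma differentiableOn_thetaNeg : DifferentiableOn ℂ thetaNeg (Metric.ball 0 1) :=
  (differentiableOn_euler.pow 2).div (differentiableOn_euler_pow two_ne_zero) fun _ hq ↦
    euler_ne_zero (norm_pow_lt_one (mem_ball_zero_iff.mp hq) two_ne_zero)

lemma differentiableOn_eulerG2 : DifferentiableOn ℂ eulerG2 (Metric.ball 0 1) :=
  differentiableOn_id.mul (((differentiableOn_euler_pow two_ne_zero).div differentiableOn_euler
    fun _ hq ↦ euler_ne_zero (mem_ball_zero_iff.mp hq)).pow 24)

lemma differentiableOn_eulerG8 : DifferentiableOn ℂ eulerG8 (Metric.ball 0 1) :=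
  differentiableOn_id.mul ((((differentiableOn_euler_pow (by norm_num)).pow 4).mul
    ((differentiableOn_euler_pow two_ne_zero).pow 2)).div
    (((differentiableOn_euler_pow (by norm_num)).pow 2).mul (differentiableOn_euler.pow 4))
    fun _ hq ↦ mul_ne_zero
      (pow_ne_zero _ (euler_ne_zero (norm_pow_lt_one (mem_ball_zero_iff.mp hq) (by norm_num))))
      (pow_ne_zero _ (euler_ne_zero (mem_ball_zero_iff.mp hq))))

lemma isTaylorOnDisc_Phi2 : IsTaylorOnDisc (fun q ↦ (thetaNeg q)⁻¹) Phi2 := by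
  obtain ⟨P, hP⟩ := IsTaylorOnDisc.exists_of_differentiableOn
    (differentiableOn_thetaNeg.inv fun q hq ↦ thetaNeg_ne_zero (mem_ball_zero_iff.mp hq))
  have h : Phi2 = P := hP.qExpansion_eq phi2_eq
  rw [h]
  exact hP

lemma isTaylorOnDisc_G2 : IsTaylorOnDisc eulerG2 G2 := by
  obtain ⟨P, hP⟩ := IsTaylorOnDisc.exists_of_differentiableOn differentiableOn_eulerG2
  rw [show G2 = P from hP.qExpansion_eq g2_eq]
  exact hP

lemma isTaylorOnDisc_G8 : IsTaylorOnDisc eulerG8 G8 := by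
  obtain ⟨P, hP⟩ := IsTaylorOnDisc.exists_of_differentiableOn differentiableOn_eulerG8
  rw [show G8 = P from hP.qExpansion_eq g8_eq]
  exact hP

/-! ### The operator U₂ on formal series and the final identity. -/

lemma atNeg_atNeg (F : PowerSeries ℂ) : atNeg (atNeg F) = F := by
  ext n
  simp [atNeg, PowerSeries.coeff_rescale, ← mul_assoc, ← mul_pow]

lemma atSq_injective : Function.Injective atSq := fun F G h ↦ by
  ext n
  have := congr_arg (PowerSeries.coeff (2 * n)) h
  simpa [atSq] using this

lemma two_mul_atSq_atkinU (F : PowerSeries ℂ) : 2 * atSq (atkinU 2 F) = F + atNeg F := by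
  ext n
  rw [show (2 : PowerSeries ℂ) = PowerSeries.C 2 from (map_ofNat _ 2).symm,
    PowerSeries.coeff_C_mul, map_add, atNeg, PowerSeries.coeff_rescale]
  rcases Nat.even_or_odd n with h | h
  · obtain ⟨k, rfl⟩ := even_iff_exists_two_mul.mp h
    rw [atSq, PowerSeries.coeff_expand_mul, atkinU, PowerSeries.coeff_mk, h.neg_one_pow]
    ring
  · rw [atSq, PowerSeries.coeff_expand_of_not_dvd _ _ _ (by rwa [← even_iff_two_dvd,
      Nat.not_even_iff_odd]), h.neg_one_pow]
    ring

lemma atNeg_mul (F G : PowerSeries ℂ) : atNeg (F * G) = atNeg F * atNeg G := map_mul _ _ _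

lemma atNeg_pow (F : PowerSeries ℂ) (n : ℕ) : atNeg (F ^ n) = atNeg F ^ n := map_pow _ _ _

lemma atSq_mul (F G : PowerSeries ℂ) : atSq (F * G) = atSq F * atSq G := map_mul _ _ _

lemma atSq_eval₂ (F : PowerSeries ℂ) (P : ℤ[X]) :
    atSq (P.eval₂ (Int.castRingHom _) F) = P.eval₂ (Int.castRingHom _) (atSq F) := by
  have h := hom_eval₂ P (Int.castRingHom _)
    (PowerSeries.expand 2 two_ne_zero : PowerSeries ℂ →ₐ[ℂ] PowerSeries ℂ).toRingHom F
  rw [RingHom.ext_int (RingHom.comp _ _) (Int.castRingHom _)] at h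
  exact h

instance : CharZero (PowerSeries ℂ) := charZero_of_injective_ringHom PowerSeries.C_injective

/-- The `U₂`-image as a polynomial in `G₈`. -/
theorem atkinU_eq_eval₂ (s : ℕ) : atkinU 2 (atNeg Phi2 * atNeg G2 ^ s) =
    atSq (atNeg Phi2) * (atkinPoly s).eval₂ (Int.castRingHom _) G8 := by
  obtain ⟨B, hB⟩ := IsTaylorOnDisc.exists_of_differentiableOn differentiableOn_thetaNeg
  have hA := hB.atNeg
  have hPB : Phi2 * B = 1 := (isTaylorOnDisc_Phi2.mul hB).unique (IsTaylorOnDisc.const 1)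
    fun q hq ↦ inv_mul_cancel₀ (thetaNeg_ne_zero hq)
  have hpA : atNeg Phi2 * atNeg B = 1 := by rw [← atNeg_mul, hPB]; exact map_one _
  have hAB4 : atNeg B + B = 2 * atSq (atSq (atNeg B)) :=
    (hA.add hB).unique (((IsTaylorOnDisc.const 2).mul hA.atSq.atSq))
      fun q hq ↦ thetaNeg_neg_add_thetaNeg hq
  have hmul : atNeg B * B = atSq B ^ 2 :=
    (hA.mul hB).unique (hB.atSq.pow 2) fun q hq ↦ thetaNeg_mul_thetaNeg_neg hq
  have hadd : atNeg B ^ 2 + B ^ 2 = 2 * atSq (atNeg B) ^ 2 :=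
    ((hA.pow 2).add (hB.pow 2)).unique ((IsTaylorOnDisc.const 2).mul (hA.atSq.pow 2))
      fun q hq ↦ thetaNeg_neg_sq_add_sq hq
  have hG8 : 8 * G8 * B ^ 2 + B ^ 2 = atNeg B ^ 2 :=
    ((((IsTaylorOnDisc.const 8).mul isTaylorOnDisc_G8).mul (hB.pow 2)).add (hB.pow 2)).unique
      (hA.pow 2) fun q hq ↦ by
        simp only [eight_mul_eulerG8 hq]; ring
  have hG2 : 16 * G2 * B ^ 8 + B ^ 4 * atNeg B ^ 4 = atNeg B ^ 8 :=
    ((((IsTaylorOnDisc.const 16).mul isTaylorOnDisc_G2).mul (hB.pow 8)).add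
      ((hB.pow 4).mul (hA.pow 4))).unique (hA.pow 8) fun q hq ↦ by
        simp only [sixteen_mul_eulerG2 hq]; ring
  have hG2' : 16 * atNeg G2 * atNeg B ^ 8 + atNeg B ^ 4 * B ^ 4 = B ^ 8 := by
    have h := congr_arg (PowerSeries.rescale (-1 : ℂ)) hG2
    simp only [map_add, map_mul, map_pow, map_ofNat] at h
    have hBB : PowerSeries.rescale (-1) (atNeg B) = B := atNeg_atNeg B
    rw [hBB] at h
    exact h
  have hy : 8 * atSq G8 * atSq B ^ 2 + atSq B ^ 2 = atSq (atNeg B) ^ 2 := by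
    have h := congr_arg (PowerSeries.expand 2 two_ne_zero) hG8
    simp only [map_add, map_mul, map_pow, map_ofNat] at h
    exact h
  have hp4 : atSq (atSq (atNeg Phi2)) * atSq (atSq (atNeg B)) = 1 := by
    rw [← atSq_mul, ← atSq_mul, hpA]
    simp [atSq]
  -- Now A = φ(q), B = φ(-q), with inverses p and `Phi2`, so u = Bp and v = A·`Phi2` exist as formal
  -- series.
  set A := atNeg B
  set p := atNeg Phi2
  have hpP : (p * A) * (Phi2 * B) = 1 := by rw [hpA, hPB, one_mul]
  have pow_eq {x z : PowerSeries ℂ} (h : x * z = 1) (n : ℕ) : x ^ n * z ^ n = 1 := by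
    rw [← mul_pow, h, one_pow]
  have key := eval₂_atkinPoly (u := B * p) (v := A * Phi2) (y := atSq G8) (g := atNeg G2) (h := G2)
    (by linear_combination hpP)
    (by
      -- Since AB = φ(-q²)² and A² + B² = 2φ(q²)², the relation for G₈ at q² reads 16yAB = (A - B)².
      -- Division by AB gives 16y = u + v - 2.
      have h1 : 16 * atSq G8 * (A * B) = (A - B) ^ 2 := by
        linear_combination 2 * hy - hadd + (16 * atSq G8 + 2) * hmul
      linear_combination p * Phi2 * h1 - 16 * atSq G8 * hpP + A * Phi2 * hpA + B * p * hPB -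
        2 * hpP)
    (by linear_combination p ^ 8 * hG2' - 16 * atNeg G2 * pow_eq hpA 8 -
      p ^ 4 * B ^ 4 * pow_eq hpA 4)
    (by linear_combination Phi2 ^ 8 * hG2 - 16 * G2 * pow_eq hPB 8 -
      Phi2 ^ 4 * A ^ 4 * pow_eq hPB 4) s
  have h4 : (4 : PowerSeries ℂ) ≠ 0 := by norm_num
  have hA4 : atSq (atSq A) ≠ 0 := right_ne_zero_of_mul_eq_one hp4
  apply atSq_injective
  -- The factor is 4φ(q⁴) = 2(A + B), and (A + B)p = 1 + u, (A + B)·`Phi2` = 1 + v.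
  apply mul_left_cancel₀ (mul_ne_zero h4 hA4)
  rw [atSq_mul, atSq_eval₂]
  have hU := two_mul_atSq_atkinU (p * atNeg G2 ^ s)
  rw [atNeg_mul, atNeg_pow, atNeg_atNeg, atNeg_atNeg] at hU
  linear_combination 2 * atSq (atSq A) * hU - (p * atNeg G2 ^ s + Phi2 * G2 ^ s) * hAB4 + key +
    (atNeg G2 ^ s) * hpA + G2 ^ s * hPB - 4 * (atkinPoly s).eval₂ (Int.castRingHom _) (atSq G8) * hp4

/-- The degree bound gives the upper end of the range, the vanishing clause of `IsGraded` the lower.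
-/
lemma eval₂_eq_sum_Icc (s : ℕ) (F : PowerSeries ℂ) : (atkinPoly s).eval₂ (Int.castRingHom _) F =
    ∑ r ∈ Finset.Icc ⌈(s : ℚ) / 2⌉₊ (8 * s + 1),
      PowerSeries.C ((atkinPoly s).coeff r : ℂ) * F ^ r := by
  rw [eval₂_eq_sum_range' _ (Nat.lt_succ_of_le (natDegree_atkinPoly_le s))]
  symm
  refine Finset.sum_subset_zero_on_sdiff (fun r hr ↦ ?_) (fun r hr ↦ ?_) fun r _ ↦ ?_
  · rw [Finset.mem_Icc] at hr
    rw [Finset.mem_range]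
    omega
  · rw [Finset.mem_sdiff, Finset.mem_range, Finset.mem_Icc, Nat.ceil_le,
      div_le_iff₀ (by norm_num)] at hr
    have h : (atkinPoly s).coeff r = 0 := by
      by_contra hne
      have h1 := (isGraded_atkinPoly s r).2 hne
      refine hr.2 ⟨?_, by omega⟩
      rw [mul_comm]
      exact_mod_cast h1
    rw [h, map_zero, zero_mul]
  · rw [map_intCast, eq_intCast]

end OverpartitionU

/-- The 2-adic valuation of an integer `c` is `emultiplicity 2 c`, which is `⊤` for `c = 0`; the
bound `2 r - s ≤ π₂(c)` is written without subtraction. -/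
theorem mainTheorem3 (s : ℕ) :
    ∃ c : ℕ → ℤ,
      OverpartitionU.atkinU 2
          (OverpartitionU.atNeg OverpartitionU.Phi2 * OverpartitionU.atNeg OverpartitionU.G2 ^ s) =
        OverpartitionU.atSq (OverpartitionU.atNeg OverpartitionU.Phi2) *
          ∑ r ∈ Finset.Icc ⌈(s : ℚ) / 2⌉₊ (8 * s + 1),
            PowerSeries.C (c r : ℂ) * OverpartitionU.G8 ^ r ∧
      ∀ r ∈ Finset.Icc ⌈(s : ℚ) / 2⌉₊ (8 * s + 1),
        2 * (r : ℕ∞) ≤ emultiplicity (2 : ℤ) (c r) + (s : ℕ∞) := by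
  refine ⟨fun r ↦ (OverpartitionU.atkinPoly s).coeff r, ?_, fun r _ ↦ ?_⟩
  · rw [OverpartitionU.atkinU_eq_eval₂, OverpartitionU.eval₂_eq_sum_Icc]
  · have h := (OverpartitionU.isGraded_atkinPoly s r).1
    -- The divisibility 2^(2r) ∣ 2^s c, read through multiplicities, is the bound itself, also for c
    -- = 0.
    rw [show (4 : ℤ) = 2 ^ 2 by norm_num, ← pow_mul, pow_dvd_iff_le_emultiplicity,
      emultiplicity_mul Int.prime_two, emultiplicity_pow_self_of_prime Int.prime_two,
      add_comm] at h
    exact_mod_cast h
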